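/- Fix a finite function-free first-order vocabulary (finitely many predicates $R\in\mathcal R$ with arities, and finitely many constants, each naming a different domain element), a first-order sentence $\Gamma$ over it, and a list $\Psi=(R_1,\dots,R_m)$ of predicates. For a finite domain $\Delta$ (which contains the elements named by the constants), a possible world $\omega$ on $\Delta$ is a set of ground atoms (those that are true), and $N(R,\omega)$ is the number of ground atoms of $R$ in $\omega$. For weight functions $w,\overline w:\mathcal R\to\mathbb Q$ put $$\mathrm{WFOMC}(\Gamma,w,\overline w,\Delta)=\sum_{\omega\models\Gamma}\ \prod_{R\in\mathcal R} w(R)^{N(R,\omega)}\,\overline w(R)^{|\Delta|^{\mathrm{arity}(R)}-N(R,\omega)},$$ where $\omega$ runs over the possible worlds on $\Delta$ that satisfy $\Gamma$; and for $\mathbf n\in\mathbb Z^m$ let $\mathrm{WMC}_{\Psi,\Gamma,\Delta}(\mathbf n,w,\overline w)$ be the same sum restricted to those $\omega\models\Gamma$ with $(N(R_1,\omega),\dots,N(R_m,\omega))=\mathbf n$. **Proposition.** Suppose that $\mathrm{WFOMC}(\Gamma,w,\overline w,\Delta)$ can be computed, from $|\Delta|$, $w$ and $\overline w$, in time polynomial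 in $|\Delta|$ and in the number of bits needed to encode $w$ and $\overline w$. Then $\mathrm{WMC}_{\Psi,\Gamma,\Delta}(\mathbf n,w,\overline w)$ can be computed, from $|\Delta|$, $w$, $\overline w$ and $\mathbf n$, in time polynomial in $|\Delta|$ and in the number of bits needed to encode $w$ and $\overline w$, for all $\mathbf n\in\prod_{i=1}^m\{0,1,\dots,|\Delta|^{\mathrm{arity}(R_i)}\}$. For every other $\mathbf n\in\mathbb Z^m$ the same algorithm is also correct (the value is $0$), in time polynomial in $|\Delta|$ and the number of bits needed to encode $w$, $\overline w$ and $\mathbf n$. Here an algorithm is a while-program with finitely many integer registers, whose instructions are assignment of a constant, addition, subtraction, multiplication, integer division and test for positivity, with logarithmic cost (each instruction costs the number of bits of the integers that it reads or loads); this is polynomially equivalent to Turing machines. Rational weights are given as reduced fractions, and a rational output is given as a fraction of integers with nonzero denominator, not necessarily reduced. The vocabulary, $\Gamma$ and $\Psi$ are fixed: the algorithms and the polynomials may depend on them, but not on $\Delta$, $w$, $\overline w$, $\mathbf n$. -/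

import Mathlib

namespace WMCFun

/-! ### Function-free first-order languages and possible worlds -/

/-- A finite function-free vocabulary: finitely many predicates with their arities, and finitely
many names of domain elements which sentences may mention. -/
structure Signature where
  numPred : ℕ
  arity : Fin numPred → ℕ
  numConst : ℕ

/-- The constant symbols, as function symbols of arity `0`; there are no others. -/
def Signature.Funs (S : Signature) : ℕ → Type
  | 0 => Fin S.numConst
  | _ + 1 => Empty

/-- The first-order language of a signature. -/
def Signature.lang (S : Signature) : FirstOrder.Language.{0, 0} where
  Functions := S.Funs
  Relations k := {R : Fin S.numPred // S.arity R = k}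

/-- Ground atoms `R(a₁, …, aₖ)` over the domain `Δ`. -/
abbrev GroundAtom (S : Signature) (Δ : Type) : Type :=
  (R : Fin S.numPred) × (Fin (S.arity R) → Δ)

/-- A possible world is the set of the ground atoms that are true in it. -/
abbrev World (S : Signature) (Δ : Type) : Type := Finset (GroundAtom S Δ)

/-- Interpretation of the constant symbols by the domain elements which they name. -/
def constMap {S : Signature} {Δ : Type} (names : Fin S.numConst ↪ Δ) : {k : ℕ} → S.Funs k → Δ
  | 0, c => names c
  | _ + 1, e => e.elim

/-- The first-order structure on `Δ` described by a possible world. -/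
@[reducible]
def World.toStructure {S : Signature} {Δ : Type} (names : Fin S.numConst ↪ Δ) (ω : World S Δ) :
    S.lang.Structure Δ where
  funMap f _ := constMap names f
  RelMap := fun R x => (⟨R.1, fun i => x (Fin.cast R.2 i)⟩ : GroundAtom S Δ) ∈ ω

/-- `ω ⊨ Γ`. -/
def World.Models {S : Signature} {Δ : Type} (names : Fin S.numConst ↪ Δ) (ω : World S Δ)
    (Γ : S.lang.Sentence) : Prop :=
  @FirstOrder.Language.Sentence.Realize S.lang Δ (World.toStructure names ω) Γ

/-- The cardinality `N(R, ω)`: the number of ground atoms of `R` that are true in `ω`. -/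
def World.count {S : Signature} {Δ : Type} (R : Fin S.numPred) (ω : World S Δ) : ℕ :=
  (ω.filter fun a => a.1 = R).card

/-! ### Weighted first-order model counts and weighted model-counting functions -/

open Classical in
/-- `WFOMC(Γ, w, w̄, Ω)` for a set `Ω` of possible worlds over `Δ`. -/
noncomputable def wfomcOn {S : Signature} {Δ : Type} [Fintype Δ] {K : Type*} [CommSemiring K]
    (names : Fin S.numConst ↪ Δ) (Γ : S.lang.Sentence) (w wbar : Fin S.numPred → K)
    (Ω : Finset (World S Δ)) : K :=
  ∑ ω ∈ Ω with World.Models names ω Γ, ∏ R : Fin S.numPred,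
    w R ^ World.count R ω * wbar R ^ (Fintype.card Δ ^ S.arity R - World.count R ω)

/-- `WFOMC(Γ, w, w̄, Δ)`: the sum over all possible worlds on `Δ`. -/
noncomputable def wfomc {S : Signature} (Δ : Type) [Fintype Δ] {K : Type*} [CommSemiring K]
    (names : Fin S.numConst ↪ Δ) (Γ : S.lang.Sentence) (w wbar : Fin S.numPred → K) : K :=
  wfomcOn names Γ w wbar (Finset.univ : Finset (World S Δ))

open Classical in
/-- `WMC_{Ψ,Ω}(n, w, w̄)` for a set `Ω` of possible worlds over `Δ`. -/
noncomputable def wmcOn {S : Signature} {Δ : Type} [Fintype Δ] {K : Type*} [CommSemiring K]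
    (names : Fin S.numConst ↪ Δ) {m : ℕ} (Ψ : Fin m → Fin S.numPred) (Ω : Finset (World S Δ))
    (n : Fin m → ℤ) (w wbar : Fin S.numPred → K) : K :=
  wfomcOn names ⊤ w wbar (Ω.filter fun ω => ∀ i, (World.count (Ψ i) ω : ℤ) = n i)

open Classical in
/-- `WMC_{Ψ,Γ,Δ}(n, w, w̄)`: the set of possible worlds is the set of models of `Γ` on `Δ`. -/
noncomputable def wmc {S : Signature} (Δ : Type) [Fintype Δ] {K : Type*} [CommSemiring K]
    (names : Fin S.numConst ↪ Δ) {m : ℕ} (Ψ : Fin m → Fin S.numPred) (Γ : S.lang.Sentence)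
    (n : Fin m → ℤ) (w wbar : Fin S.numPred → K) : K :=
  wmcOn names Ψ ((Finset.univ : Finset (World S Δ)).filter fun ω => World.Models names ω Γ)
    n w wbar

/-! ### Machine model: register programs over the integers with logarithmic cost

A program uses finitely many registers, each holding an integer of any size. The cost of every
instruction is the number of bits of the integers that it reads (the logarithmic cost criterion
for random access machines). Since an instruction can add at most as many bits to the memory as
it costs, and binary strings and stacks can be held in single registers and manipulated by
arithmetic with `2`, polynomial time on this model is polynomial time on Turing machines. -/

/-- Number of bits of an integer, with one bit for the sign. -/
def bitLen (z : ℤ) : ℕ := z.natAbs.size + 1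

/-- The arithmetical operations. -/
inductive Op
  | add
  | sub
  | mul
  | div

/-- Meaning of an operation; `div` is integer division, with value `0` for divisor `0`. -/
def Op.eval : Op → ℤ → ℤ → ℤ
  | .add, a, b => a + b
  | .sub, a, b => a - b
  | .mul, a, b => a * b
  | .div, a, b => a / b

/-- Programs; registers are numbered by natural numbers. -/
inductive Prog
  | skip
  /-- `x := c` -/
  | const (x : ℕ) (c : ℤ)
  /-- `x := y ∘ z` -/
  | op (o : Op) (x y z : ℕ)
  | seq (P Q : Prog)
  /-- if `x > 0` then `P` else `Q` -/
  | ite (x : ℕ) (P Q : Prog)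
  /-- while `x > 0` do `P` -/
  | while (x : ℕ) (P : Prog)

/-- Contents of the registers. -/
abbrev Store : Type := ℕ → ℤ

/-- `Runs P s t s'`: started in `s`, the program `P` halts in `s'` after time `t`. -/
inductive Runs : Prog → Store → ℕ → Store → Prop
  | skip (s : Store) : Runs .skip s 1 s
  | const (s : Store) (x : ℕ) (c : ℤ) :
      Runs (.const x c) s (bitLen c) (Function.update s x c)
  | op (s : Store) (o : Op) (x y z : ℕ) :
      Runs (.op o x y z) s (bitLen (s y) + bitLen (s z))
        (Function.update s x (o.eval (s y) (s z)))
  | seq {P Q : Prog} {s s' s'' : Store} {t t' : ℕ} (hP : Runs P s t s') (hQ : Runs Q s' t' s'') :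
      Runs (.seq P Q) s (t + t') s''
  | ite_pos {x : ℕ} {P Q : Prog} {s s' : Store} {t : ℕ} (hx : 0 < s x) (hP : Runs P s t s') :
      Runs (.ite x P Q) s (bitLen (s x) + t) s'
  | ite_nonpos {x : ℕ} {P Q : Prog} {s s' : Store} {t : ℕ} (hx : s x ≤ 0) (hQ : Runs Q s t s') :
      Runs (.ite x P Q) s (bitLen (s x) + t) s'
  | while_pos {x : ℕ} {P : Prog} {s s' s'' : Store} {t t' : ℕ} (hx : 0 < s x)
      (hP : Runs P s t s') (hloop : Runs (.while x P) s' t' s'') :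
      Runs (.while x P) s (bitLen (s x) + t + t') s''
  | while_nonpos {x : ℕ} {P : Prog} {s : Store} (hx : s x ≤ 0) :
      Runs (.while x P) s (bitLen (s x)) s

/-- The initial store: the input in the first registers, `0` in all others. -/
def load (l : List ℤ) : Store := fun j => l.getD j 0

/-- On the given input, `P` halts within time `T` and outputs the rational number `v` as a
fraction: its numerator in register `0` and its (nonzero) denominator in register `1`. -/
def ComputesWithin (P : Prog) (input : List ℤ) (T : ℕ) (v : ℚ) : Prop :=
  ∃ (t : ℕ) (s : Store), Runs P (load input) t s ∧ t ≤ T ∧ s 1 ≠ 0 ∧ (s 0 : ℚ) / (s 1 : ℚ) = v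

/-! ### Computing WFOMC and WMC-functions in polynomial time -/

/-- Number of bits needed to write down `w` and `w̄` as reduced fractions. -/
def weightBits {r : ℕ} (w wbar : Fin r → ℚ) : ℕ :=
  ∑ R, (bitLen (w R).num + bitLen (w R).den + bitLen (wbar R).num + bitLen (wbar R).den)

/-- The weights as a list of integers. -/
def weightInput {r : ℕ} (w wbar : Fin r → ℚ) : List ℤ :=
  (List.ofFn fun R => [(w R).num, ((w R).den : ℤ), (wbar R).num, ((wbar R).den : ℤ)]).flatten

/-- `WFOMC(Γ, w, w̄, Δ)` with rational weights can be computed, from `|Δ|`, `w` and `w̄`, in time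
polynomial in `|Δ|` and the number of bits of `w` and `w̄`. -/
def WfomcPolyTime {S : Signature} (Γ : S.lang.Sentence) : Prop :=
  ∃ (P : Prog) (p : Polynomial ℕ),
    ∀ (Δ : Type) [Fintype Δ] (names : Fin S.numConst ↪ Δ) (w wbar : Fin S.numPred → ℚ),
      ComputesWithin P ((Fintype.card Δ : ℤ) :: weightInput w wbar)
        (p.eval (Fintype.card Δ + weightBits w wbar))
        (wfomc Δ names Γ w wbar)

/-- `WMC_{Ψ,Γ,Δ}(n, w, w̄)` with rational weights can be computed, from `|Δ|`, `w`, `w̄` and `n`, in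
time polynomial in `|Δ|` and the number of bits of `w` and `w̄` for every `n` in the range
`∏ᵢ {0, …, |Δ| ^ arity (Ψ i)}` of the cardinality vectors. The same program is also correct for all
other integer vectors `n` (where the value is `0`), in time polynomial in the number of bits of
the whole input, the bits of `n` included. -/
def WmcPolyTime {S : Signature} (Γ : S.lang.Sentence) {m : ℕ} (Ψ : Fin m → Fin S.numPred) : Prop :=
  ∃ (P : Prog) (p q : Polynomial ℕ),
    ∀ (Δ : Type) [Fintype Δ] (names : Fin S.numConst ↪ Δ) (w wbar : Fin S.numPred → ℚ)
      (n : Fin m → ℤ),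
      ((∀ i, 0 ≤ n i ∧ n i ≤ (Fintype.card Δ : ℤ) ^ S.arity (Ψ i)) →
        ComputesWithin P ((Fintype.card Δ : ℤ) :: (weightInput w wbar ++ List.ofFn n))
          (p.eval (Fintype.card Δ + weightBits w wbar))
          (wmc Δ names Ψ Γ n w wbar)) ∧
      ComputesWithin P ((Fintype.card Δ : ℤ) :: (weightInput w wbar ++ List.ofFn n))
        (q.eval (Fintype.card Δ + weightBits w wbar + ∑ i, bitLen (n i)))
        (wmc Δ names Ψ Γ n w wbar)

end WMCFun

namespace WMCFun

/-! ### Polynomially bounded functions -/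

/-! One weighted model count with suitably large weights already contains every value of the
counting function, as digits in a large base (Kronecker substitution). Multiplying `w R` and `wbar
R` by both their denominators makes all weights integers and scales every world by the same factor
(`wmc_clearedWeight`). Then multiply `w (Ψ i)` by `X ^ U ^ i`. A world with counts `Nᵢ` gains the
factor `X ^ ∑ Nᵢ U ^ i`; for `U` above all counts the exponent determines the count vector. If `X`
exceeds twice the sum of the absolute weights, the coefficient of each power of `X` is recovered by
rounded division (`coeffAt_sum_mul_pow`, `coeffAt_wfomc`).

All this takes polynomial time: arities and `m` are fixed, so `U`, its powers and the exponents of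
`X` are polynomial in `|Δ|`, and the new weights have polynomially many bits. To prove it for
register programs, `PolyComp` is shown closed under arithmetic, branching, powers with small
exponents and subroutine calls (`PolyComp.pow`, `PolyComp.call`). Running time and bit length are
controlled together, since a register cannot grow by more bits than the time spent
(`Runs.bitLen_le`). -/

/-- `g` is bounded by a polynomial in the size `sz` of the instance. -/
def PolyBdd {I : Type*} (sz g : I → ℕ) : Prop :=
  ∃ p : Polynomial ℕ, ∀ i, g i ≤ p.eval (sz i)

theorem eval_nat_mono (p : Polynomial ℕ) : Monotone fun x : ℕ => p.eval x := by
  intro x y h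
  simp only [Polynomial.eval_eq_sum, Polynomial.sum]
  exact Finset.sum_le_sum fun k _ => Nat.mul_le_mul_left _ (Nat.pow_le_pow_left h k)

namespace PolyBdd

variable {I : Type*} {sz g h : I → ℕ}

theorem mono (hg : PolyBdd sz g) (H : ∀ i, h i ≤ g i) : PolyBdd sz h :=
  hg.imp fun _ hp i => (H i).trans (hp i)

theorem const (c : ℕ) : PolyBdd sz fun _ => c :=
  ⟨Polynomial.C c, fun i => by simp⟩

theorem size : PolyBdd sz sz :=
  ⟨Polynomial.X, fun i => by simp⟩

theorem add (hg : PolyBdd sz g) (hh : PolyBdd sz h) : PolyBdd sz fun i => g i + h i := by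
  obtain ⟨p, hp⟩ := hg
  obtain ⟨q, hq⟩ := hh
  exact ⟨p + q, fun i => by simpa using Nat.add_le_add (hp i) (hq i)⟩

theorem mul (hg : PolyBdd sz g) (hh : PolyBdd sz h) : PolyBdd sz fun i => g i * h i := by
  obtain ⟨p, hp⟩ := hg
  obtain ⟨q, hq⟩ := hh
  exact ⟨p * q, fun i => by simpa using Nat.mul_le_mul (hp i) (hq i)⟩

theorem pow (hg : PolyBdd sz g) (k : ℕ) : PolyBdd sz fun i => g i ^ k := by
  obtain ⟨p, hp⟩ := hg
  exact ⟨p ^ k, fun i => by simpa using Nat.pow_le_pow_left (hp i) k⟩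

theorem eval (hg : PolyBdd sz g) (q : Polynomial ℕ) : PolyBdd sz fun i => q.eval (g i) := by
  obtain ⟨p, hp⟩ := hg
  exact ⟨q.comp p, fun i => by simpa using eval_nat_mono q (hp i)⟩

theorem sum {κ : Type*} {g : κ → I → ℕ} (s : Finset κ) (hg : ∀ k ∈ s, PolyBdd sz (g k)) :
    PolyBdd sz fun i => ∑ k ∈ s, g k i := by
  classical
  induction s using Finset.induction_on with
  | empty => simpa using const 0
  | insert a s ha ih =>
    simp only [Finset.sum_insert ha]
    exact (hg a (by simp)).add (ih fun k hk => hg k (by simp [hk]))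

end PolyBdd

/-! ### Bit lengths -/

theorem bitLen_le_iff {z : ℤ} {k : ℕ} : bitLen z ≤ k + 1 ↔ z.natAbs < 2 ^ k := by
  simp [bitLen, Nat.size_le]

theorem natAbs_lt_two_pow (z : ℤ) : z.natAbs < 2 ^ z.natAbs.size := Nat.lt_size_self _

theorem bitLen_le_natAbs (z : ℤ) : bitLen z ≤ z.natAbs + 1 :=
  bitLen_le_iff.2 Nat.lt_two_pow_self

theorem bitLen_mul_le (a b : ℤ) : bitLen (a * b) ≤ a.natAbs.size + b.natAbs.size + 1 := by
  rw [bitLen_le_iff, Int.natAbs_mul, pow_add]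
  exact Nat.mul_lt_mul'' (natAbs_lt_two_pow a) (natAbs_lt_two_pow b)

theorem natAbs_add_lt (a b : ℤ) :
    a.natAbs + b.natAbs < 2 ^ (a.natAbs.size + b.natAbs.size + 1) := by
  have ha := natAbs_lt_two_pow a
  have hb := natAbs_lt_two_pow b
  have ha' : 2 ^ a.natAbs.size ≤ 2 ^ (a.natAbs.size + b.natAbs.size) :=
    Nat.pow_le_pow_right (by norm_num) (by omega)
  have hb' : 2 ^ b.natAbs.size ≤ 2 ^ (a.natAbs.size + b.natAbs.size) :=
    Nat.pow_le_pow_right (by norm_num) (by omega)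
  rw [pow_succ]
  omega

theorem bitLen_eval_le (o : Op) (a b : ℤ) : bitLen (o.eval a b) ≤ bitLen a + bitLen b := by
  cases o with
  | add =>
    exact (bitLen_le_iff.2 ((Int.natAbs_add_le a b).trans_lt (natAbs_add_lt a b))).trans
      (by simp only [bitLen]; omega)
  | sub =>
    exact (bitLen_le_iff.2 ((Int.natAbs_sub_le a b).trans_lt (natAbs_add_lt a b))).trans
      (by simp only [bitLen]; omega)
  | mul => exact (bitLen_mul_le a b).trans (by simp only [bitLen]; omega)
  | div =>
    have h : bitLen (a / b) ≤ bitLen a :=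
      Nat.succ_le_succ (Nat.size_le_size (Int.natAbs_ediv_le_natAbs a b))
    exact h.trans (Nat.le_add_right _ _)

theorem bitLen_pow_le (a : ℤ) (k : ℕ) : bitLen (a ^ k) ≤ k * bitLen a + 2 := by
  induction k with
  | zero => simp [bitLen]
  | succ k ih =>
    have := bitLen_mul_le (a ^ k) a
    rw [← pow_succ] at this
    rw [Nat.succ_mul]
    simp only [bitLen] at *
    omega

/-! ### Executions -/

/-- Logarithmic cost charges each instruction at least the bits of the value it writes. Hence time
bounds are also size bounds. -/
theorem Runs.bitLen_le {P : Prog} {s s' : Store} {t : ℕ} (h : Runs P s t s') (j : ℕ) :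
    bitLen (s' j) ≤ bitLen (s j) + t := by
  induction h with
  | skip s => omega
  | const s x c =>
    by_cases hj : j = x
    · subst hj; simp
    · simp [Function.update_of_ne hj]
  | op s o x y z =>
    by_cases hj : j = x
    · subst hj
      simpa using (bitLen_eval_le o (s y) (s z)).trans (Nat.le_add_left _ _)
    · simp [Function.update_of_ne hj]
  | seq _ _ ih₁ ih₂ => omega
  | ite_pos _ _ ih => omega
  | ite_nonpos _ _ ih => omega
  | while_pos _ _ _ ih₁ ih₂ => omega
  | while_nonpos _ => omega

/-- The program with all its register numbers increased by `b`. -/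
def Prog.shift (b : ℕ) : Prog → Prog
  | .skip => .skip
  | .const x c => .const (b + x) c
  | .op o x y z => .op o (b + x) (b + y) (b + z)
  | .seq P Q => .seq (P.shift b) (Q.shift b)
  | .ite x P Q => .ite (b + x) (P.shift b) (Q.shift b)
  | .while x P => .while (b + x) (P.shift b)

/-- A number larger than the numbers of all registers of a program. -/
def Prog.numRegs : Prog → ℕ
  | .skip => 0
  | .const x _ => x + 1
  | .op _ x y z => x + y + z + 1
  | .seq P Q => P.numRegs + Q.numRegs
  | .ite x P Q => x + 1 + P.numRegs + Q.numRegs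
  | .while x P => x + 1 + P.numRegs

/-- Relocation of a subroutine: only registers below `P.numRegs` can influence a run. The window `K`
may be larger, so that an output register not mentioned in `P` can still be read off. -/
theorem Runs.shift {P : Prog} {s s' : Store} {t : ℕ} (h : Runs P s t s') (b K : ℕ) :
    P.numRegs ≤ K → ∀ u : Store, (∀ j < K, u (b + j) = s j) →
    ∃ u', Runs (P.shift b) u t u' ∧ (∀ j < K, u' (b + j) = s' j) ∧ ∀ j < b, u' j = u j := by
  induction h with
  | skip s => exact fun _ u hu => ⟨u, .skip u, hu, fun _ _ => rfl⟩
  | const s x c =>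
    refine fun _ u hu => ⟨_, .const u _ c, fun j hj => ?_, fun j hj => ?_⟩
    · by_cases hjx : j = x
      · subst hjx; simp
      · rw [Function.update_of_ne hjx, Function.update_of_ne (by omega), hu j hj]
    · rw [Function.update_of_ne (by omega)]
  | op s o x y z =>
    intro hK u hu
    simp only [Prog.numRegs] at hK
    rw [← hu y (by omega), ← hu z (by omega)]
    refine ⟨_, .op u o _ _ _, fun j hj => ?_, fun j hj => ?_⟩
    · by_cases hjx : j = x
      · subst hjx; simp
      · rw [Function.update_of_ne hjx, Function.update_of_ne (by omega), hu j hj]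
    · rw [Function.update_of_ne (by omega)]
  | seq _ _ ih₁ ih₂ =>
    intro hK u hu
    simp only [Prog.numRegs] at hK
    obtain ⟨u₁, h₁, h₁', h₁''⟩ := ih₁ (by omega) u hu
    obtain ⟨u₂, h₂, h₂', h₂''⟩ := ih₂ (by omega) u₁ h₁'
    exact ⟨u₂, .seq h₁ h₂, h₂', fun j hj => (h₂'' j hj).trans (h₁'' j hj)⟩
  | ite_pos hx _ ih =>
    intro hK u hu
    simp only [Prog.numRegs] at hK
    obtain ⟨u₁, h₁, h₁'⟩ := ih (by omega) u hu
    rw [← hu _ (by omega)] at hx ⊢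
    exact ⟨u₁, .ite_pos hx h₁, h₁'⟩
  | ite_nonpos hx _ ih =>
    intro hK u hu
    simp only [Prog.numRegs] at hK
    obtain ⟨u₁, h₁, h₁'⟩ := ih (by omega) u hu
    rw [← hu _ (by omega)] at hx ⊢
    exact ⟨u₁, .ite_nonpos hx h₁, h₁'⟩
  | while_pos hx _ _ ih₁ ih₂ =>
    intro hK u hu
    have hK' := hK
    simp only [Prog.numRegs] at hK'
    obtain ⟨u₁, h₁, h₁', h₁''⟩ := ih₁ (by omega) u hu
    obtain ⟨u₂, h₂, h₂', h₂''⟩ := ih₂ hK u₁ h₁'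
    rw [← hu _ (by omega)] at hx ⊢
    exact ⟨u₂, .while_pos hx h₁ h₂, h₂', fun j hj => (h₂'' j hj).trans (h₁'' j hj)⟩
  | while_nonpos hx =>
    intro hK u hu
    simp only [Prog.numRegs] at hK
    rw [← hu _ (by omega)] at hx ⊢
    exact ⟨u, .while_nonpos hx, hu, fun _ _ => rfl⟩

/-! ### Functions computable in polynomial time -/

/-- On each instance `i`, whose input is held in the first `L` registers, the program `Q` halts
within time `T i`, leaves the values `f 0, …, f (k - 1)` in the registers from `b` on, and does not
change the registers below `b`. -/
def Evaluates {I : Type*} (inp : I → Store) (L b : ℕ) (Q : Prog) (T : I → ℕ) (k : ℕ)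
    (f : I → ℕ → ℤ) : Prop :=
  ∀ i s, (∀ j < L, s j = inp i j) → ∃ t s', Runs Q s t s' ∧ t ≤ T i ∧
    (∀ j < k, s' (b + j) = f i j) ∧ ∀ j < b, s' j = s j

/-- `f` can be computed from the input, which is held in the first `L` registers, in time polynomial
in the size `sz` of the instance, with any later registers as work space. -/
def PolyComp {I : Type*} (sz : I → ℕ) (inp : I → Store) (L : ℕ) (f : I → ℤ) : Prop :=
  ∀ b ≥ L, ∃ Q T, PolyBdd sz T ∧ Evaluates inp L b Q T 1 fun i _ => f i

/-- The second program works from `b + k₁` on, so it disturbs neither the input nor the results of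
the first. This is why work space may start at any `b ≥ L` in `PolyComp`. -/
theorem Evaluates.seq {I : Type*} {inp : I → Store} {L b k₁ k₂ : ℕ} {Q₁ Q₂ : Prog} {T₁ T₂ : I → ℕ}
    {f₁ f₂ : I → ℕ → ℤ} (hb : L ≤ b) (h₁ : Evaluates inp L b Q₁ T₁ k₁ f₁)
    (h₂ : Evaluates inp L (b + k₁) Q₂ T₂ k₂ f₂) :
    Evaluates inp L b (.seq Q₁ Q₂) (fun i => T₁ i + T₂ i) (k₁ + k₂)
      fun i j => if j < k₁ then f₁ i j else f₂ i (j - k₁) := by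
  intro i s hs
  obtain ⟨t₁, s₁, hr₁, ht₁, hv₁, hf₁⟩ := h₁ i s hs
  obtain ⟨t₂, s₂, hr₂, ht₂, hv₂, hf₂⟩ := h₂ i s₁ fun j hj => by rw [hf₁ j (by omega), hs j hj]
  refine ⟨_, s₂, .seq hr₁ hr₂, Nat.add_le_add ht₁ ht₂, fun j hj => ?_, fun j hj => ?_⟩
  · dsimp only
    split_ifs with hjk
    · rw [hf₂ _ (by omega), hv₁ j hjk]
    · rw [← hv₂ (j - k₁) (by omega)]
      congr 1
      omega
  · rw [hf₂ j (by omega), hf₁ j hj]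

/-! ### Closure properties of polynomial-time computability. -/

namespace PolyComp

variable {I : Type*} {sz : I → ℕ} {inp : I → Store} {L : ℕ} {f g e : I → ℤ}

theorem congr (hf : PolyComp sz inp L f) (h : ∀ i, g i = f i) : PolyComp sz inp L g := by
  rwa [funext h]

theorem bitLen (hf : PolyComp sz inp L f) : PolyBdd sz fun i => bitLen (f i) := by
  obtain ⟨Q, T, hT, hQ⟩ := hf L le_rfl
  refine ((PolyBdd.const 1).add hT).mono fun i => ?_
  -- With the work space empty, the output register starts with a single bit, and the run time
  -- bounds its growth.
  obtain ⟨t, s', hr, ht, hv, -⟩ := hQ i (fun j => if j < L then inp i j else 0)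
    fun j hj => by simp [hj]
  have := hr.bitLen_le L
  have hv0 := hv 0 one_pos
  simp only [add_zero] at hv0
  rw [hv0] at this
  simp only [lt_irrefl, if_false] at this
  have h0 : WMCFun.bitLen 0 = 1 := by simp [WMCFun.bitLen]
  omega

theorem const (c : ℤ) : PolyComp sz inp L fun _ => c := by
  refine fun b _ => ⟨.const b c, fun _ => WMCFun.bitLen c, .const _, fun i s _ =>
    ⟨_, _, .const s b c, le_rfl, fun j hj => ?_, fun j hj => ?_⟩⟩
  · obtain rfl : j = 0 := by omega
    simp
  · rw [Function.update_of_ne (by omega)]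

theorem input (k : ℕ) (hk : k < L) (hs : PolyBdd sz fun i => WMCFun.bitLen (inp i k)) :
    PolyComp sz inp L fun i => inp i k := by
  refine fun b hb => ⟨.seq (.const b 0) (.op .add b k b), _, (PolyBdd.const 2).add hs,
    fun i s h => ⟨_, _, .seq (.const s b 0) (.op _ .add b k b), ?_, fun j hj => ?_, fun j hj => ?_⟩⟩
  · rw [Function.update_of_ne (by omega), h k hk]
    simp [WMCFun.bitLen]
    omega
  · obtain rfl : j = 0 := by omega
    simp [Op.eval, Function.update_of_ne (show k ≠ b by omega), h k hk]
  · rw [Function.update_of_ne (by omega), Function.update_of_ne (by omega)]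

theorem list : ∀ (l : List (I → ℤ)), (∀ f ∈ l, PolyComp sz inp L f) → ∀ b ≥ L,
    ∃ Q T, PolyBdd sz T ∧ Evaluates inp L b Q T l.length fun i j => (l.map (· i)).getD j 0
  | [], _, b, _ => ⟨.skip, _, .const 1, fun i s _ => ⟨1, s, .skip s, le_rfl, by simp, fun _ _ => rfl⟩⟩
  | f :: l, h, b, hb => by
    obtain ⟨Q₁, T₁, hT₁, h₁⟩ := h f (by simp) b hb
    obtain ⟨Q₂, T₂, hT₂, h₂⟩ := list l (fun g hg => h g (by simp [hg])) (b + 1) (by omega)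
    refine ⟨.seq Q₁ Q₂, _, hT₁.add hT₂, ?_⟩
    have := Evaluates.seq hb h₁ h₂
    intro i s hs
    obtain ⟨t, s', hr, ht, hv, hf⟩ := this i s hs
    refine ⟨t, s', hr, ht, fun j hj => ?_, hf⟩
    rw [hv j (by simpa [add_comm] using hj)]
    cases j <;> simp

theorem op (o : Op) (hf : PolyComp sz inp L f) (hg : PolyComp sz inp L g) :
    PolyComp sz inp L fun i => o.eval (f i) (g i) := by
  intro b hb
  obtain ⟨Q, T, hT, hQ⟩ := list (sz := sz) (inp := inp) [f, g] (by simp [hf, hg]) b hb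
  refine ⟨.seq Q (.op o b b (b + 1)), _, hT.add (hf.bitLen.add hg.bitLen), fun i s hs => ?_⟩
  obtain ⟨t, s', hr, ht, hv, hfr⟩ := hQ i s hs
  have h0 : s' b = f i := by simpa using hv 0 (by simp)
  have h1 : s' (b + 1) = g i := by simpa using hv 1 (by simp)
  refine ⟨_, _, .seq hr (.op s' o b b (b + 1)), by rw [h0, h1]; omega, fun j hj => ?_,
    fun j hj => ?_⟩
  · obtain rfl : j = 0 := by omega
    simp [h0, h1]
  · rw [Function.update_of_ne (by omega), hfr j hj]

theorem add (hf : PolyComp sz inp L f) (hg : PolyComp sz inp L g) :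
    PolyComp sz inp L fun i => f i + g i := op .add hf hg

theorem sub (hf : PolyComp sz inp L f) (hg : PolyComp sz inp L g) :
    PolyComp sz inp L fun i => f i - g i := op .sub hf hg

theorem mul (hf : PolyComp sz inp L f) (hg : PolyComp sz inp L g) :
    PolyComp sz inp L fun i => f i * g i := op .mul hf hg

theorem div (hf : PolyComp sz inp L f) (hg : PolyComp sz inp L g) :
    PolyComp sz inp L fun i => f i / g i := op .div hf hg

theorem sum {κ : Type*} {f : κ → I → ℤ} (s : Finset κ) (hf : ∀ k ∈ s, PolyComp sz inp L (f k)) :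
    PolyComp sz inp L fun i => ∑ k ∈ s, f k i := by
  classical
  induction s using Finset.induction_on with
  | empty => simpa using const 0
  | insert a s ha ih =>
    simp only [Finset.sum_insert ha]
    exact (hf a (by simp)).add (ih fun k hk => hf k (by simp [hk]))

theorem prod {κ : Type*} {f : κ → I → ℤ} (s : Finset κ) (hf : ∀ k ∈ s, PolyComp sz inp L (f k)) :
    PolyComp sz inp L fun i => ∏ k ∈ s, f k i := by
  classical
  induction s using Finset.induction_on with
  | empty => simpa using const 1
  | insert a s ha ih =>
    simp only [Finset.prod_insert ha]
    exact (hf a (by simp)).mul (ih fun k hk => hf k (by simp [hk]))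

theorem pow_const (hf : PolyComp sz inp L f) (k : ℕ) : PolyComp sz inp L fun i => f i ^ k := by
  simpa using prod (Finset.range k) (f := fun _ => f) fun _ _ => hf

theorem ite (he : PolyComp sz inp L e) (hf : PolyComp sz inp L f) (hg : PolyComp sz inp L g) :
    PolyComp sz inp L fun i => if 0 < e i then f i else g i := by
  intro b hb
  obtain ⟨Q, T, hT, hQ⟩ := he b hb
  obtain ⟨Q₁, T₁, hT₁, h₁⟩ := hf b hb
  obtain ⟨Q₂, T₂, hT₂, h₂⟩ := hg b hb
  refine ⟨.seq Q (.ite b Q₁ Q₂), _, hT.add (he.bitLen.add (hT₁.add hT₂)), fun i s hs => ?_⟩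
  obtain ⟨t, s', hr, ht, hv, hfr⟩ := hQ i s hs
  have hs' : ∀ j < L, s' j = inp i j := fun j hj => by rw [hfr j (by omega), hs j hj]
  have h0 : s' b = e i := by simpa using hv 0 (by simp)
  by_cases hpos : 0 < e i
  · obtain ⟨t₁, s₁, hr₁, ht₁, hv₁, hf₁⟩ := h₁ i s' hs'
    refine ⟨_, s₁, .seq hr (.ite_pos (h0 ▸ hpos) hr₁), by rw [h0]; omega, fun j hj => ?_,
      fun j hj => by rw [hf₁ j hj, hfr j hj]⟩
    rw [hv₁ j hj]
    exact (if_pos hpos).symm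
  · obtain ⟨t₁, s₁, hr₁, ht₁, hv₁, hf₁⟩ := h₂ i s' hs'
    refine ⟨_, s₁, .seq hr (.ite_nonpos (h0 ▸ not_lt.1 hpos) hr₁), by rw [h0]; omega,
      fun j hj => ?_, fun j hj => by rw [hf₁ j hj, hfr j hj]⟩
    rw [hv₁ j hj]
    exact (if_neg hpos).symm

/-- Multiplies register `b` by the power of register `b + 1` with exponent in register `b + 2`;
register `b + 3` holds the number `1`. -/
def powLoop (b : ℕ) : Prog :=
  .while (b + 2) (.seq (.op .mul b b (b + 1)) (.op .sub (b + 2) (b + 2) (b + 3)))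

/-- If `A` bounds the bits of base, exponent and all partial products, a round costs at most `A` for
the test, `2 * A` for the product and `A + 2` for the decrement. -/
theorem runs_powLoop (b : ℕ) (x : ℤ) (A : ℕ) (hx : WMCFun.bitLen x ≤ A) (k : ℕ) :
    ∀ (y e : ℤ) (s : Store), e.toNat = k → WMCFun.bitLen e + k ≤ A →
    (∀ j ≤ k, WMCFun.bitLen (y * x ^ j) ≤ A) →
    s b = y → s (b + 1) = x → s (b + 2) = e → s (b + 3) = 1 →
    ∃ t s', Runs (powLoop b) s t s' ∧ t ≤ (k + 1) * (4 * A + 2) ∧ s' b = y * x ^ k ∧ ∀ j < b, s' j = s j := by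
  induction k with
  | zero =>
    intro y e s hk he _ h0 _ h2 _
    refine ⟨_, s, .while_nonpos (by rw [h2]; omega), ?_, by simp [h0], fun _ _ => rfl⟩
    rw [h2]
    omega
  | succ k ih =>
    intro y e s hk he hA h0 h1 h2 h3
    have he1 : WMCFun.bitLen (e - 1) + k ≤ A := by
      have : WMCFun.bitLen (e - 1) ≤ WMCFun.bitLen e := by
        unfold WMCFun.bitLen
        exact Nat.succ_le_succ (Nat.size_le_size (by omega))
      omega
    let s₁ := Function.update s b (y * x)
    let s₂ := Function.update s₁ (b + 2) (e - 1)
    have hr₁ : Runs (.op .mul b b (b + 1)) s (WMCFun.bitLen y + WMCFun.bitLen x) s₁ := by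
      have := Runs.op s .mul b b (b + 1)
      rwa [h0, h1] at this
    have hr₂ : Runs (.op .sub (b + 2) (b + 2) (b + 3)) s₁ (WMCFun.bitLen e + WMCFun.bitLen 1) s₂ := by
      have := Runs.op s₁ .sub (b + 2) (b + 2) (b + 3)
      have e2 : s₁ (b + 2) = e := by simp [s₁, h2]
      have e3 : s₁ (b + 3) = 1 := by simp [s₁, h3]
      rwa [e2, e3] at this
    obtain ⟨t, s', hr, ht, hv, hf⟩ := ih (y * x) (e - 1) s₂ (by omega) he1
      (fun j hj => by
        have := hA (j + 1) (by omega)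
        rwa [pow_succ', ← mul_assoc] at this)
      (by simp [s₂, s₁]) (by simp [s₂, s₁, h1]) (by simp [s₂]) (by simp [s₂, s₁, h3])
    refine ⟨_, s', .while_pos (by rw [h2]; omega) (.seq hr₁ hr₂) hr, ?_, ?_, fun j hj => ?_⟩
    · have hy := hA 0 (by omega)
      simp only [pow_zero, mul_one] at hy
      have hone : WMCFun.bitLen 1 = 2 := by simp [WMCFun.bitLen]
      rw [h2, hone, Nat.succ_mul (k + 1)]
      omega
    · rw [hv, pow_succ', mul_assoc]
    · rw [hf j hj]
      simp only [s₂, s₁]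
      rw [Function.update_of_ne (by omega), Function.update_of_ne (by omega)]

/-- The exponent must be polynomially bounded in value, not just in bit length: it is the number of
rounds and multiplies the bit length of the result. -/
theorem pow (hf : PolyComp sz inp L f) {e : I → ℕ}
    (he : PolyComp sz inp L fun i => (e i : ℤ)) (hbd : PolyBdd sz e) :
    PolyComp sz inp L fun i => f i ^ e i := by
  intro b hb
  obtain ⟨Q, T, hT, hQ⟩ := list (sz := sz) (inp := inp) [fun _ => 1, f, fun i => e i, fun _ => 1]
    (by simp [hf, he, const 1]) b hb
  let A : I → ℕ := fun i =>
    e i * WMCFun.bitLen (f i) + 2 + WMCFun.bitLen (f i) + WMCFun.bitLen (e i : ℤ) + e i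
  have hA : PolyBdd sz A :=
    ((((hbd.mul hf.bitLen).add (.const 2)).add hf.bitLen).add he.bitLen).add hbd
  refine ⟨.seq Q (powLoop b), _, hT.add ((hbd.add (.const 1)).mul (((PolyBdd.const 4).mul hA).add (.const 2))),
    fun i s hs => ?_⟩
  obtain ⟨t, s', hr, ht, hv, hfr⟩ := hQ i s hs
  obtain ⟨t₁, s₁, hr₁, ht₁, hv₁, hf₁⟩ := runs_powLoop b (f i) (A i)
    (by simp only [A]; omega) (e i) 1 (e i) s' (by simp) (by simp only [A]; omega)
    (fun j hj => by
      rw [one_mul]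
      have h1 := bitLen_pow_le (f i) j
      have h2 := Nat.mul_le_mul_right (WMCFun.bitLen (f i)) hj
      simp only [A]
      omega)
    (by simpa using hv 0 (by simp)) (by simpa using hv 1 (by simp))
    (by simpa using hv 2 (by simp)) (by simpa using hv 3 (by simp))
  refine ⟨_, s₁, .seq hr hr₁, Nat.add_le_add ht ht₁, fun j hj => ?_, fun j hj => ?_⟩
  · obtain rfl : j = 0 := by omega
    simpa using hv₁
  · rw [hf₁ j hj, hfr j hj]

theorem call (P : Prog) (l : List (I → ℤ)) (hl : ∀ f ∈ l, PolyComp sz inp L f) {T : I → ℕ}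
    (hT : PolyBdd sz T) {out : I → Store}
    (hP : ∀ i, ∃ t ≤ T i, Runs P (load (l.map (· i))) t (out i)) (k : ℕ) :
    PolyComp sz inp L fun i => out i k := by
  intro b hb
  -- The work space may hold anything, whereas `load` puts `0` after the input. The appended zeros
  -- reproduce this in all registers that `P` uses and in output register `k`.
  obtain ⟨Q, T', hT', hQ⟩ := list (l ++ List.replicate (P.numRegs + k + 1) fun _ => 0)
    (fun f hf => by
      rcases List.mem_append.1 hf with h | h
      · exact hl f h
      · rw [List.eq_of_mem_replicate h]
        exact const 0) b hb
  have hout : PolyBdd sz fun i => WMCFun.bitLen (out i k) := by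
    have hin : PolyBdd sz fun i => WMCFun.bitLen (load (l.map (· i)) k) := by
      by_cases hk : k < l.length
      · refine (hl _ (List.getElem_mem hk)).bitLen.mono fun i => ?_
        simp [load, hk]
      · refine (PolyBdd.const 1).mono fun i => ?_
        simp [load, List.getElem?_eq_none (not_lt.1 hk), WMCFun.bitLen]
    refine (hin.add hT).mono fun i => ?_
    obtain ⟨t, ht, hr⟩ := hP i
    exact (hr.bitLen_le k).trans (by omega)
  refine ⟨.seq Q (.seq (P.shift b) (.seq (.const (b + k + 1) 0) (.op .add b (b + k) (b + k + 1)))), _,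
    hT'.add (hT.add ((PolyBdd.const 2).add hout)), fun i s hs => ?_⟩
  obtain ⟨t, s', hr, ht, hv, hfr⟩ := hQ i s hs
  obtain ⟨t₁, ht₁, hr₁⟩ := hP i
  obtain ⟨s₁, hrs, hv₁, hf₁⟩ := hr₁.shift b (P.numRegs + k + 1) (by omega) s' fun j hj => by
    rw [hv j (by simp; omega)]
    simp only [load, List.map_append, List.map_replicate]
    by_cases hjl : j < l.length
    · rw [List.getD_append _ _ _ _ (by simpa using hjl)]
    · rw [List.getD_append_right _ _ _ _ (by simpa using hjl),
        List.getD_eq_default (l.map (· i)) _ (by simpa using hjl)]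
      simp only [List.getD_eq_getElem?_getD, List.getElem?_replicate]
      split_ifs <;> rfl
  have hk := hv₁ k (by omega)
  refine ⟨_, _, .seq hr (.seq hrs (.seq (.const s₁ _ 0) (.op _ .add b _ _))), ?_, fun j hj => ?_,
    fun j hj => ?_⟩
  · have h0 : WMCFun.bitLen 0 = 1 := by simp [WMCFun.bitLen]
    simp only [Function.update_self, h0]
    rw [Function.update_of_ne (by omega), hk]
    omega
  · obtain rfl : j = 0 := by omega
    simp [Op.eval, hk]
  · rw [Function.update_of_ne (by omega), Function.update_of_ne (by omega), hf₁ j hj, hfr j hj]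

end PolyComp

theorem exists_computesWithin {I : Type*} {sz : I → ℕ} {inp : I → List ℤ} {L : ℕ} {f g : I → ℤ}
    (hL : 2 ≤ L) (hf : PolyComp sz (fun i => load (inp i)) L f)
    (hg : PolyComp sz (fun i => load (inp i)) L g) (hg0 : ∀ i, g i ≠ 0) :
    ∃ (P : Prog) (T : I → ℕ), PolyBdd sz T ∧
      ∀ i, ComputesWithin P (inp i) (T i) ((f i : ℚ) / g i) := by
  obtain ⟨Q, T, hT, hQ⟩ := PolyComp.list (sz := sz) (inp := fun i => load (inp i)) [f, g] (by simp [hf, hg]) L le_rfl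
  -- As `2 ≤ L`, writing registers `0` and `1` does not overwrite the results in `L` and `L + 1`.
  refine ⟨.seq Q (.seq (.seq (.const 0 0) (.op .add 0 0 L)) (.seq (.const 1 0) (.op .add 1 1 (L + 1)))),
    _, hT.add ((PolyBdd.const 4).add (hf.bitLen.add hg.bitLen)), fun i => ?_⟩
  obtain ⟨t, s, hr, ht, hv, -⟩ := hQ i (load (inp i)) fun _ _ => rfl
  have h0 : s L = f i := by simpa using hv 0 (by simp)
  have h1 : s (L + 1) = g i := by simpa using hv 1 (by simp)
  have b0 : bitLen 0 = 1 := by simp [bitLen]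
  refine ⟨_, _, .seq hr (.seq (.seq (.const _ _ _) (.op _ _ _ _ _))
    (.seq (.const _ _ _) (.op _ _ _ _ _))), ?_, ?_, ?_⟩
  · simp [b0, Op.eval, Function.update_of_ne (show L ≠ 0 by omega),
      Function.update_of_ne (show L + 1 ≠ 1 by omega), h0, h1]
    omega
  · simp [Op.eval, Function.update_of_ne (show L + 1 ≠ 1 by omega), h1, hg0]
  · simp [Op.eval, Function.update_of_ne (show L + 1 ≠ 1 by omega),
      Function.update_of_ne (show L ≠ 0 by omega), h0, h1]



/-! ### Extracting the coefficients of a sparse sum of powers of a large base -/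

/-- The quotient is `Y / X ^ E` rounded to the nearest integer, where `Y` is the sum. Terms with
exponent at least `E` are divisible by `X ^ E`; the others total less than half of `X ^ E` in
absolute value, whatever their signs. -/
theorem round_sum_mul_pow {ι : Type*} (s : Finset ι) (a : ι → ℤ) (k : ι → ℕ) {X : ℤ}
    (hX : 2 * ∑ i ∈ s, |a i| < X) (E : ℕ) :
    (2 * (∑ i ∈ s, a i * X ^ k i) + X ^ E) / (2 * X ^ E) =
      ∑ i ∈ s with E ≤ k i, a i * X ^ (k i - E) := by
  have hsum : 0 ≤ ∑ i ∈ s, |a i| := Finset.sum_nonneg fun i _ => abs_nonneg _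
  have hX1 : 1 ≤ X := by omega
  have hXE : 0 < X ^ E := by positivity
  set W : ℤ := ∑ i ∈ s with ¬ E ≤ k i, a i * X ^ k i with hW
  set Z : ℤ := ∑ i ∈ s with E ≤ k i, a i * X ^ (k i - E) with hZ
  have hsplit : ∑ i ∈ s, a i * X ^ k i = Z * X ^ E + W := by
    rw [← Finset.sum_filter_add_sum_filter_not s (fun i => E ≤ k i), hZ, Finset.sum_mul]
    congr 1
    refine Finset.sum_congr rfl fun i hi => ?_
    rw [mul_assoc, ← pow_add, Nat.sub_add_cancel (Finset.mem_filter.1 hi).2]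
  have hWlt : 2 * |W| < X ^ E := by
    rcases Nat.eq_zero_or_pos E with rfl | hE
    · simp [hW]
    · have h1 : |W| ≤ (∑ i ∈ s, |a i|) * X ^ (E - 1) := by
        calc |W| ≤ ∑ i ∈ s with ¬ E ≤ k i, |a i * X ^ k i| := Finset.abs_sum_le_sum_abs _ _
          _ ≤ ∑ i ∈ s with ¬ E ≤ k i, |a i| * X ^ (E - 1) := by
              refine Finset.sum_le_sum fun i hi => ?_
              have := (Finset.mem_filter.1 hi).2
              rw [abs_mul, abs_of_nonneg (by positivity : (0 : ℤ) ≤ X ^ k i)]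
              exact mul_le_mul_of_nonneg_left (pow_le_pow_right₀ hX1 (by omega)) (abs_nonneg _)
          _ ≤ ∑ i ∈ s, |a i| * X ^ (E - 1) :=
              Finset.sum_le_sum_of_subset_of_nonneg (Finset.filter_subset _ _)
                fun i _ _ => by positivity
          _ = _ := by rw [Finset.sum_mul]
      calc 2 * |W| ≤ (2 * ∑ i ∈ s, |a i|) * X ^ (E - 1) := by rw [mul_assoc]; omega
        _ < X * X ^ (E - 1) := mul_lt_mul_of_pos_right hX (by positivity)
        _ = X ^ E := mul_pow_sub_one hE.ne' X
  have hW' := abs_le.1 (le_refl |W|)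
  rw [hsplit, show 2 * (Z * X ^ E + W) + X ^ E = (2 * W + X ^ E) + Z * (2 * X ^ E) by ring,
    Int.add_mul_ediv_right _ _ (by positivity),
    Int.ediv_eq_zero_of_lt (by omega) (by omega), zero_add]

/-- The coefficient of `X ^ E` in the expansion of `Y` in powers of `X` with small integer
coefficients. -/
def coeffAt (Y X : ℤ) (E : ℕ) : ℤ :=
  (2 * Y + X ^ E) / (2 * X ^ E) - X * ((2 * Y + X ^ (E + 1)) / (2 * X ^ (E + 1)))

/-- Rounding at `E` keeps the terms with `k i ≥ E`; subtracting `X` times the rounding at `E + 1`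
removes those with `k i > E`. -/
theorem coeffAt_sum_mul_pow {ι : Type*} (s : Finset ι) (a : ι → ℤ) (k : ι → ℕ) {X : ℤ}
    (hX : 2 * ∑ i ∈ s, |a i| < X) (E : ℕ) :
    coeffAt (∑ i ∈ s, a i * X ^ k i) X E = ∑ i ∈ s with k i = E, a i := by
  rw [coeffAt, round_sum_mul_pow s a k hX, round_sum_mul_pow s a k hX, Finset.mul_sum,
    sub_eq_iff_eq_add, ← Finset.sum_filter_add_sum_filter_not _ (fun i => k i = E),
    Finset.filter_filter, Finset.filter_filter]
  congr 1
  · refine Finset.sum_congr (Finset.filter_congr fun i _ => by omega) fun i hi => ?_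
    rw [(Finset.mem_filter.1 hi).2]
    simp
  · refine Finset.sum_congr (Finset.filter_congr fun i _ => by omega) fun i hi => ?_
    have := (Finset.mem_filter.1 hi).2
    rw [show k i - E = k i - (E + 1) + 1 by omega]
    ring

theorem sum_mul_pow_injective {m U : ℕ} {a b : Fin m → ℕ} (ha : ∀ i, a i < U) (hb : ∀ i, b i < U)
    (h : ∑ i, a i * U ^ (i : ℕ) = ∑ i, b i * U ^ (i : ℕ)) : a = b := by
  have : (fun i => (⟨a i, ha i⟩ : Fin U)) = fun i => ⟨b i, hb i⟩ := by
    apply finFunctionFinEquiv.injective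
    ext
    simpa [finFunctionFinEquiv_apply] using h
  funext i
  simpa using congrFun this i

/-! ### Counting models through their weights -/

section Counting

variable {S : Signature} {Δ : Type} [Fintype Δ] (names : Fin S.numConst ↪ Δ)

/-- The number of ground atoms over a domain with `d` elements. -/
def Signature.numAtoms (S : Signature) (d : ℕ) : ℕ := ∑ R, d ^ S.arity R

theorem World.count_le (R : Fin S.numPred) (ω : World S Δ) :
    World.count R ω ≤ Fintype.card Δ ^ S.arity R := by
  classical
  calc World.count R ω
      ≤ ((Finset.univ : Finset (Fin (S.arity R) → Δ)).map
          (Function.Embedding.sigmaMk (β := fun R => Fin (S.arity R) → Δ) R)).card := by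
        refine Finset.card_le_card fun a ha => ?_
        obtain ⟨R', x⟩ := a
        obtain rfl : R' = R := (Finset.mem_filter.1 ha).2
        simp
    _ = _ := by simp

theorem World.count_le_numAtoms (R : Fin S.numPred) (ω : World S Δ) :
    World.count R ω ≤ S.numAtoms (Fintype.card Δ) :=
  (count_le R ω).trans (Finset.single_le_sum
    (f := fun R => Fintype.card Δ ^ S.arity R) (fun _ _ => Nat.zero_le _) (Finset.mem_univ R))

/-- The weight of a possible world. -/
def World.weight {K : Type*} [CommSemiring K] (w wbar : Fin S.numPred → K) (ω : World S Δ) : K :=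
  ∏ R, w R ^ World.count R ω * wbar R ^ (Fintype.card Δ ^ S.arity R - World.count R ω)

open Classical in
theorem wfomc_eq_sum {K : Type*} [CommSemiring K] (Γ : S.lang.Sentence) (w wbar : Fin S.numPred → K) :
    wfomc Δ names Γ w wbar = ∑ ω : World S Δ with World.Models names ω Γ, ω.weight w wbar :=
  rfl

open Classical in
theorem wmc_eq_sum {K : Type*} [CommSemiring K] {m : ℕ} (Ψ : Fin m → Fin S.numPred)
    (Γ : S.lang.Sentence) (n : Fin m → ℤ) (w wbar : Fin S.numPred → K) :
    wmc Δ names Ψ Γ n w wbar =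
      ∑ ω ∈ {ω : World S Δ | World.Models names ω Γ} with ∀ i, (World.count (Ψ i) ω : ℤ) = n i,
        ω.weight w wbar := by
  unfold wmc wmcOn wfomcOn World.weight
  -- Every world satisfies `⊤`, so the filter inside `wfomcOn` is vacuous.
  refine Finset.sum_congr (Finset.filter_true_of_mem fun ω _ => ?_) fun _ _ => rfl
  simp [World.Models, FirstOrder.Language.Sentence.Realize]

theorem wfomc_intCast (Γ : S.lang.Sentence) (w wbar : Fin S.numPred → ℤ) :
    wfomc Δ names Γ (fun R => (w R : ℚ)) (fun R => (wbar R : ℚ)) = wfomc Δ names Γ w wbar := by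
  simp [wfomc_eq_sum, World.weight]

theorem wmc_eq_zero {K : Type*} [CommSemiring K] {m : ℕ} (Ψ : Fin m → Fin S.numPred)
    (Γ : S.lang.Sentence) (n : Fin m → ℤ) (w wbar : Fin S.numPred → K) (i : Fin m)
    (hi : n i < 0 ∨ (S.numAtoms (Fintype.card Δ) : ℤ) < n i) :
    wmc Δ names Ψ Γ n w wbar = 0 := by
  rw [wmc_eq_sum, Finset.filter_false_of_mem, Finset.sum_empty]
  intro ω _ h
  have := h i
  have := World.count_le_numAtoms (Ψ i) ω
  omega

theorem World.abs_weight_le {w wbar : Fin S.numPred → ℤ} {V : ℤ} (hw : ∀ R, |w R| ≤ V)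
    (hwbar : ∀ R, |wbar R| ≤ V) (ω : World S Δ) :
    |ω.weight w wbar| ≤ V ^ S.numAtoms (Fintype.card Δ) := by
  rw [World.weight, Finset.abs_prod, Signature.numAtoms, ← Finset.prod_pow_eq_pow_sum]
  refine Finset.prod_le_prod (fun R _ => abs_nonneg _) fun R _ => ?_
  have hV : 0 ≤ V := (abs_nonneg _).trans (hw R)
  calc |w R ^ count R ω * wbar R ^ (Fintype.card Δ ^ S.arity R - count R ω)|
      ≤ V ^ count R ω * V ^ (Fintype.card Δ ^ S.arity R - count R ω) := by
        rw [abs_mul, abs_pow, abs_pow]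
        exact mul_le_mul (pow_le_pow_left₀ (abs_nonneg _) (hw R) _)
          (pow_le_pow_left₀ (abs_nonneg _) (hwbar R) _) (by positivity) (by positivity)
    _ = V ^ Fintype.card Δ ^ S.arity R := by
        rw [← pow_add, Nat.add_sub_cancel' (count_le R ω)]

/-- There are `2 ^ numAtoms` worlds, each of absolute weight at most `V ^ numAtoms`. -/
theorem World.sum_abs_weight_le {w wbar : Fin S.numPred → ℤ} {V : ℤ} (hw : ∀ R, |w R| ≤ V)
    (hwbar : ∀ R, |wbar R| ≤ V) (s : Finset (World S Δ)) :
    ∑ ω ∈ s, |ω.weight w wbar| ≤ (2 * V) ^ S.numAtoms (Fintype.card Δ) := by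
  classical
  calc ∑ ω ∈ s, |ω.weight w wbar|
      ≤ ∑ ω : World S Δ, |ω.weight w wbar| :=
        Finset.sum_le_sum_of_subset_of_nonneg (Finset.subset_univ s) fun _ _ _ => abs_nonneg _
    _ ≤ ∑ _ω : World S Δ, V ^ S.numAtoms (Fintype.card Δ) :=
        Finset.sum_le_sum fun ω _ => abs_weight_le hw hwbar ω
    _ = (2 * V) ^ S.numAtoms (Fintype.card Δ) := by
        rw [Finset.sum_const, Finset.card_univ, Fintype.card_finset, Fintype.card_sigma, mul_pow]
        simp [Signature.numAtoms]

/-- A predicate listed several times in `Ψ` receives all the corresponding factors, hence the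
product over the fibre of `Ψ`. -/
theorem World.weight_mul_prod_pow {m : ℕ} (Ψ : Fin m → Fin S.numPred) (U : ℕ) (X : ℤ)
    (w wbar : Fin S.numPred → ℤ) (ω : World S Δ) :
    ω.weight (fun R => w R * ∏ i with Ψ i = R, X ^ U ^ (i : ℕ)) wbar =
      ω.weight w wbar * X ^ ∑ i, World.count (Ψ i) ω * U ^ (i : ℕ) := by
  have h : ∏ R, (∏ i with Ψ i = R, X ^ U ^ (i : ℕ)) ^ World.count R ω =
      X ^ ∑ i, World.count (Ψ i) ω * U ^ (i : ℕ) := by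
    rw [← Finset.prod_pow_eq_pow_sum,
      ← Finset.prod_fiberwise_of_maps_to (g := Ψ) (fun i _ => Finset.mem_univ (Ψ i))]
    refine Finset.prod_congr rfl fun R _ => ?_
    rw [← Finset.prod_pow]
    refine Finset.prod_congr rfl fun i hi => ?_
    rw [(Finset.mem_filter.1 hi).2, ← pow_mul, mul_comm]
  rw [← h, World.weight, World.weight, ← Finset.prod_mul_distrib]
  refine Finset.prod_congr rfl fun R _ => ?_
  rw [mul_pow]
  ring

/-- A single weighted model count, with weights multiplied by powers of a large number `X`, has all
the values of the weighted model-counting function as its digits. -/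
theorem coeffAt_wfomc {m : ℕ} (Ψ : Fin m → Fin S.numPred) (Γ : S.lang.Sentence)
    {w wbar : Fin S.numPred → ℤ} {V : ℤ} (hw : ∀ R, |w R| ≤ V) (hwbar : ∀ R, |wbar R| ≤ V)
    {U : ℕ} (hU : S.numAtoms (Fintype.card Δ) < U) {X : ℤ}
    (hX : 2 * (2 * V) ^ S.numAtoms (Fintype.card Δ) < X) {e : Fin m → ℕ} (he : ∀ i, e i < U) :
    coeffAt (wfomc Δ names Γ (fun R => w R * ∏ i with Ψ i = R, X ^ U ^ (i : ℕ)) wbar) X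
      (∑ i, e i * U ^ (i : ℕ)) = wmc Δ names Ψ Γ (fun i => (e i : ℤ)) w wbar := by
  classical
  rw [wfomc_eq_sum, wmc_eq_sum]
  simp only [World.weight_mul_prod_pow]
  rw [coeffAt_sum_mul_pow _ _ _
    ((mul_le_mul_of_nonneg_left (World.sum_abs_weight_le hw hwbar _) zero_le_two).trans_lt hX)]
  refine Finset.sum_congr (Finset.filter_congr fun ω _ => ⟨fun h i => ?_, fun h => ?_⟩)
    fun _ _ => rfl
  -- Equal exponents of `X` force equal counts, by uniqueness of base-`U` digits.
  · rw [sum_mul_pow_injective (fun i => (World.count_le_numAtoms _ ω).trans_lt hU) he h |>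
      fun h => congrFun h i]
  · exact Finset.sum_congr rfl fun i _ => by rw [Int.ofNat_inj.1 (h i)]

/-- The integer weight of `R` after clearing the denominators of `w R` and `wbar R`. -/
def clearedWeight {r : ℕ} (w wbar : Fin r → ℚ) (R : Fin r) : ℤ := (w R).num * (wbar R).den

/-- Each ground atom of `R`, true or false, contributes exactly one weight and hence one factor `(w
R).den * (wbar R).den`; the total scaling does not depend on the world. -/
theorem wmc_clearedWeight {m : ℕ} (Ψ : Fin m → Fin S.numPred) (Γ : S.lang.Sentence)
    (n : Fin m → ℤ) (w wbar : Fin S.numPred → ℚ) :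
    ((wmc Δ names Ψ Γ n (clearedWeight w wbar) (clearedWeight wbar w) : ℤ) : ℚ) =
      wmc Δ names Ψ Γ n w wbar *
        ((∏ R, ((w R).den * (wbar R).den : ℤ) ^ Fintype.card Δ ^ S.arity R : ℤ) : ℚ) := by
  rw [wmc_eq_sum, wmc_eq_sum, Finset.sum_mul]
  push_cast
  refine Finset.sum_congr rfl fun ω _ => ?_
  simp only [World.weight, clearedWeight]
  push_cast
  rw [← Finset.prod_mul_distrib]
  refine Finset.prod_congr rfl fun R _ => ?_
  obtain ⟨c, hc⟩ := Nat.exists_eq_add_of_le (World.count_le R ω)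
  rw [hc, Nat.add_sub_cancel_left]
  have h1 : ((w R).num : ℚ) = w R * (w R).den := (Rat.mul_den_eq_num _).symm
  have h2 : ((wbar R).num : ℚ) = wbar R * (wbar R).den := (Rat.mul_den_eq_num _).symm
  rw [h1, h2]
  ring

end Counting



/-! ### Reading the input -/

theorem length_flatten_ofFn {r c : ℕ} (F : Fin r → List ℤ) (hF : ∀ R, (F R).length = c) :
    (List.ofFn F).flatten.length = r * c := by
  rw [List.length_flatten, List.map_ofFn, List.sum_ofFn]
  simp [hF]

theorem getD_flatten_ofFn {r c : ℕ} (F : Fin r → List ℤ) (hF : ∀ R, (F R).length = c)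
    (R : Fin r) {j : ℕ} (hj : j < c) :
    (List.ofFn F).flatten.getD (c * R + j) 0 = (F R).getD j 0 := by
  induction r with
  | zero => exact R.elim0
  | succ r ih =>
    rw [List.ofFn_succ, List.flatten_cons]
    cases R using Fin.cases with
    | zero => rw [List.getD_append _ _ _ _ (by simp [hF, hj])]; simp
    | succ R =>
      rw [List.getD_append_right _ _ _ _ (by rw [hF, Fin.val_succ, Nat.mul_succ]; omega), hF,
        Fin.val_succ, Nat.mul_succ, show c * (R : ℕ) + c + j - c = c * R + j by omega]
      exact ih (fun R => F R.succ) (fun R => hF _) R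

theorem length_weightInput {r : ℕ} (w wbar : Fin r → ℚ) :
    (weightInput w wbar).length = r * 4 :=
  length_flatten_ofFn _ fun _ => rfl

/-- An instance of the problem of computing a weighted model-counting function. -/
structure Instance (S : Signature) (m : ℕ) where
  Δ : Type
  [fintype : Fintype Δ]
  names : Fin S.numConst ↪ Δ
  w : Fin S.numPred → ℚ
  wbar : Fin S.numPred → ℚ
  n : Fin m → ℤ

namespace Instance

attribute [instance] Instance.fintype

variable {S : Signature} {m : ℕ}

/-- The cardinality of the domain. -/
abbrev card (i : Instance S m) : ℕ := Fintype.card i.Δ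

/-- The number of bits of an instance, with the size of the domain in unary. -/
def size (i : Instance S m) : ℕ := i.card + weightBits i.w i.wbar + ∑ k, bitLen (i.n k)

/-- An instance as a list of integers. -/
def input (i : Instance S m) : List ℤ :=
  (i.card : ℤ) :: (weightInput i.w i.wbar ++ List.ofFn i.n)

/-- The number of integers in the input. -/
def inputLength (S : Signature) (m : ℕ) : ℕ := 2 + S.numPred * 4 + m

/-- Computability of `f` in polynomial time from the input of an instance. -/
abbrev Comp (f : Instance S m → ℤ) : Prop :=
  PolyComp size (fun i => load i.input) (inputLength S m) f

theorem polyBdd_card : PolyBdd size (card : Instance S m → ℕ) :=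
  PolyBdd.size.mono fun i => by unfold size; omega

theorem comp_card : Comp fun i : Instance S m => (i.card : ℤ) := by
  refine (PolyComp.input 0 (by unfold inputLength; omega) ?_).congr fun i => rfl
  exact (polyBdd_card.add (.const 1)).mono fun i => bitLen_le_natAbs _

theorem load_input_weight (i : Instance S m) (R : Fin S.numPred) {j : ℕ} (hj : j < 4) :
    load i.input (4 * R + j + 1) =
      [(i.w R).num, ((i.w R).den : ℤ), (i.wbar R).num, ((i.wbar R).den : ℤ)].getD j 0 := by
  unfold load input
  rw [List.getD_cons_succ, List.getD_append _ _ _ _ (by rw [length_weightInput]; omega)]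
  exact getD_flatten_ofFn (c := 4) (fun R => [_, _, _, _]) (fun _ => rfl) R hj

theorem load_input_n (i : Instance S m) (k : Fin m) :
    load i.input (S.numPred * 4 + k + 1) = i.n k := by
  unfold load input
  rw [List.getD_cons_succ, List.getD_append_right _ _ _ _ (by rw [length_weightInput]; omega),
    length_weightInput, Nat.add_sub_cancel_left]
  simp [List.getD_eq_getElem?_getD]

theorem bits_le_size (i : Instance S m) (R : Fin S.numPred) :
    bitLen (i.w R).num + bitLen (i.w R).den + bitLen (i.wbar R).num + bitLen (i.wbar R).den ≤
      i.size := by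
  have := Finset.single_le_sum (f := fun R => bitLen (i.w R).num + bitLen (i.w R).den +
    bitLen (i.wbar R).num + bitLen (i.wbar R).den) (fun _ _ => Nat.zero_le _) (Finset.mem_univ R)
  unfold size weightBits
  omega

theorem comp_weight (R : Fin S.numPred) {j : ℕ} (hj : j < 4) : Comp fun i : Instance S m =>
    [(i.w R).num, ((i.w R).den : ℤ), (i.wbar R).num, ((i.wbar R).den : ℤ)].getD j 0 := by
  refine (PolyComp.input (4 * R + j + 1) (by unfold inputLength; omega) ?_).congr
    fun i => (load_input_weight i R hj).symm
  refine PolyBdd.size.mono fun i => ?_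
  rw [load_input_weight i R hj]
  have := bits_le_size i R
  interval_cases j <;> simp only [List.getD_cons_zero, List.getD_cons_succ] <;> omega

theorem comp_num (R : Fin S.numPred) : Comp fun i : Instance S m => (i.w R).num :=
  comp_weight R (j := 0) (by norm_num)

theorem comp_den (R : Fin S.numPred) : Comp fun i : Instance S m => ((i.w R).den : ℤ) :=
  comp_weight R (j := 1) (by norm_num)

theorem comp_num_bar (R : Fin S.numPred) : Comp fun i : Instance S m => (i.wbar R).num :=
  comp_weight R (j := 2) (by norm_num)

theorem comp_den_bar (R : Fin S.numPred) : Comp fun i : Instance S m => ((i.wbar R).den : ℤ) :=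
  comp_weight R (j := 3) (by norm_num)

theorem comp_n (k : Fin m) : Comp fun i : Instance S m => i.n k := by
  refine (PolyComp.input (S.numPred * 4 + k + 1) (by unfold inputLength; omega) ?_).congr
    fun i => (load_input_n i k).symm
  refine PolyBdd.size.mono fun i => ?_
  rw [load_input_n]
  have := Finset.single_le_sum (f := fun k => bitLen (i.n k)) (fun _ _ => Nat.zero_le _)
    (Finset.mem_univ k)
  unfold size
  omega

/-! ### The quantities computed by the algorithm -/

/-- The integer weights of the instance. -/
abbrev α (i : Instance S m) : Fin S.numPred → ℤ := clearedWeight i.w i.wbar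

/-- The integer complementary weights of the instance. -/
abbrev β (i : Instance S m) : Fin S.numPred → ℤ := clearedWeight i.wbar i.w

/-- A number larger than all cardinalities of predicates. -/
def U (i : Instance S m) : ℕ := S.numAtoms i.card + 1

/-- A bound for the integer weights. -/
def V (i : Instance S m) : ℤ := 2 + ∑ R, (i.α R ^ 2 + i.β R ^ 2)

/-- A base in which the values of the weighted model-counting function are digits. -/
def X (i : Instance S m) : ℤ := (2 * i.V) ^ i.U

/-- The weights for which the model count is called. -/
def callWeight (Ψ : Fin m → Fin S.numPred) (i : Instance S m) (R : Fin S.numPred) : ℤ :=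
  i.α R * ∏ k with Ψ k = R, i.X ^ i.U ^ (k : ℕ)

/-- The cardinality vector, with the components out of range replaced by `0`. -/
def e (i : Instance S m) (k : Fin m) : ℕ :=
  (if 0 < i.n k then if 0 < i.U - i.n k then i.n k else 0 else 0).toNat

/-- The position of the digit that is to be found. -/
def pos (i : Instance S m) : ℕ := ∑ k, i.e k * i.U ^ (k : ℕ)

/-- The common denominator of the values. -/
def denom (i : Instance S m) : ℤ :=
  ∏ R, ((i.w R).den * (i.wbar R).den : ℤ) ^ i.card ^ S.arity R

/-- `1` if the cardinality vector is in range, otherwise `0`. -/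
def inRange (i : Instance S m) : ℤ :=
  ∏ k, if 0 < i.n k + 1 then if 0 < i.U - i.n k then 1 else 0 else 0

theorem comp_α (R : Fin S.numPred) : Comp fun i : Instance S m => i.α R :=
  (comp_num R).mul (comp_den_bar R)

theorem comp_β (R : Fin S.numPred) : Comp fun i : Instance S m => i.β R :=
  (comp_num_bar R).mul (comp_den R)

theorem comp_card_pow (k : ℕ) : Comp fun i : Instance S m => ((i.card ^ k : ℕ) : ℤ) :=
  (comp_card.pow_const k).congr fun i => by push_cast; rfl

theorem comp_U_pow (k : ℕ) : Comp fun i : Instance S m => ((i.U ^ k : ℕ) : ℤ) := by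
  have h := (PolyComp.sum Finset.univ fun R _ => comp_card_pow (S := S) (m := m) (S.arity R)).add
    (.const 1)
  exact (h.pow_const k).congr fun i => by simp [U, Signature.numAtoms]

theorem comp_U : Comp fun i : Instance S m => (i.U : ℤ) := by
  simpa using comp_U_pow (S := S) (m := m) 1

theorem polyBdd_U : PolyBdd size (U : Instance S m → ℕ) :=
  (PolyBdd.sum Finset.univ fun R _ => polyBdd_card.pow (S.arity R)).add (.const 1)

theorem comp_X : Comp (X : Instance S m → ℤ) := by
  have hV : Comp (V : Instance S m → ℤ) := (PolyComp.const 2).add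
    (.sum Finset.univ fun R _ => ((comp_α R).pow_const 2).add ((comp_β R).pow_const 2))
  exact ((PolyComp.const 2).mul hV).pow comp_U polyBdd_U

theorem comp_callWeight (Ψ : Fin m → Fin S.numPred) (R : Fin S.numPred) :
    Comp fun i : Instance S m => callWeight Ψ i R :=
  (comp_α R).mul (.prod _ fun k _ => comp_X.pow (comp_U_pow k) (polyBdd_U.pow k))

/-- Replacing out-of-range components keeps `pos` polynomially bounded even when `n` is
exponentially large, so that `X ^ pos` remains computable. -/
theorem e_lt_U (i : Instance S m) (k : Fin m) : i.e k < i.U := by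
  have : 0 < i.U := Nat.succ_pos _
  unfold e
  split_ifs <;> omega

theorem comp_e (k : Fin m) : Comp fun i : Instance S m => (i.e k : ℤ) := by
  refine ((comp_n k).ite ((comp_U.sub (comp_n k)).ite (comp_n k) (.const 0)) (.const 0)).congr
    fun i => ?_
  unfold e
  split_ifs <;> omega

theorem comp_pos : Comp fun i : Instance S m => (i.pos : ℤ) :=
  (PolyComp.sum Finset.univ fun k _ => (comp_e k).mul (comp_U_pow k)).congr fun i => by simp [pos]

theorem polyBdd_pos : PolyBdd size (pos : Instance S m → ℕ) :=
  .sum Finset.univ fun k _ => (polyBdd_U.mono fun i => (e_lt_U i k).le).mul (polyBdd_U.pow k)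

theorem comp_denom : Comp (denom : Instance S m → ℤ) :=
  .prod Finset.univ fun R _ => ((comp_den R).mul (comp_den_bar R)).pow (comp_card_pow _)
    (polyBdd_card.pow _)

theorem denom_ne_zero (i : Instance S m) : i.denom ≠ 0 :=
  Finset.prod_ne_zero_iff.2 fun R _ => pow_ne_zero _
    (mul_ne_zero (by exact_mod_cast (i.w R).den_nz) (by exact_mod_cast (i.wbar R).den_nz))

theorem comp_inRange : Comp (inRange : Instance S m → ℤ) :=
  .prod Finset.univ fun k _ => ((comp_n k).add (.const 1)).ite
    ((comp_U.sub (comp_n k)).ite (.const 1) (.const 0)) (.const 0)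

theorem comp_coeffAt {Y : Instance S m → ℤ} (hY : Comp Y) :
    Comp fun i : Instance S m => coeffAt (Y i) i.X i.pos := by
  have hround : ∀ c : ℕ, Comp fun i : Instance S m =>
      (2 * Y i + i.X ^ (i.pos + c)) / (2 * i.X ^ (i.pos + c)) := fun c => by
    have hpow := comp_X.pow (e := fun i : Instance S m => i.pos + c)
      ((comp_pos.add (.const (c : ℤ))).congr fun i => by push_cast; rfl)
      (polyBdd_pos.add (.const c))
    exact (((PolyComp.const 2).mul hY).add hpow).div ((PolyComp.const 2).mul hpow)
  exact (hround 0).sub (comp_X.mul (hround 1))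

/-! ### Correctness of the decoding, and the call of the given algorithm. -/

theorem abs_le_V (i : Instance S m) (R : Fin S.numPred) : |i.α R| ≤ i.V ∧ |i.β R| ≤ i.V := by
  have h := Finset.single_le_sum (f := fun R => i.α R ^ 2 + i.β R ^ 2)
    (fun _ _ => by positivity) (Finset.mem_univ R)
  -- Squares stand in for absolute values in `V`, being directly computable by multiplication.
  have hsq : ∀ x : ℤ, |x| ≤ x ^ 2 := fun x => by
    rw [← sq_abs]; exact Int.le_self_sq _
  have h1 := hsq (i.α R)
  have h2 := hsq (i.β R)
  have h3 := sq_nonneg (i.α R)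
  have h4 := sq_nonneg (i.β R)
  unfold V
  constructor <;> linarith

theorem two_le_V (i : Instance S m) : 2 ≤ i.V :=
  le_add_of_nonneg_right (Finset.sum_nonneg fun _ _ => by positivity)

/-- The exponent `U = numAtoms + 1` supplies an extra factor `2 * V ≥ 4`, which beats `2`. -/
theorem lt_X (i : Instance S m) : 2 * (2 * i.V) ^ S.numAtoms i.card < i.X := by
  have hV := i.two_le_V
  rw [X, U, pow_succ']
  exact mul_lt_mul_of_pos_right (by linarith) (by positivity)

theorem inRange_mul_coeffAt (Ψ : Fin m → Fin S.numPred) (Γ : S.lang.Sentence) (i : Instance S m) :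
    ((i.inRange * coeffAt (wfomc i.Δ i.names Γ (callWeight Ψ i) i.β) i.X i.pos : ℤ) : ℚ) /
      (i.denom : ℚ) = wmc i.Δ i.names Ψ Γ i.n i.w i.wbar := by
  have hd : (i.denom : ℚ) ≠ 0 := by exact_mod_cast i.denom_ne_zero
  rw [div_eq_iff hd]
  -- Out of this range the digit at `pos` belongs to another vector, so `inRange` must cancel it.
  -- Within it, a component above its own `|Δ| ^ arity` needs no care: that digit is already `0`.
  by_cases h : ∀ k, 0 ≤ i.n k ∧ i.n k < i.U
  · have hr : i.inRange = 1 := Finset.prod_eq_one fun k _ => by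
      rw [if_pos (by have := h k; omega), if_pos (by have := h k; omega)]
    have he : (fun k => (i.e k : ℤ)) = i.n := funext fun k => by
      have := h k
      unfold e
      split_ifs <;> omega
    have key := coeffAt_wfomc i.names Ψ Γ (fun R => (i.abs_le_V R).1) (fun R => (i.abs_le_V R).2)
      (Nat.lt_succ_self _) i.lt_X i.e_lt_U
    rw [he] at key
    rw [hr, one_mul]
    exact (congrArg (Int.cast (R := ℚ)) key).trans (wmc_clearedWeight i.names Ψ Γ i.n i.w i.wbar)
  · obtain ⟨k, hk⟩ := not_forall.1 h
    have hr : i.inRange = 0 := Finset.prod_eq_zero (Finset.mem_univ k) (by split_ifs <;> omega)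
    rw [hr, wmc_eq_zero i.names Ψ Γ i.n i.w i.wbar k (by unfold U card at hk; push_cast at hk; omega)]
    simp

theorem weightInput_intCast {r : ℕ} (a b : Fin r → ℤ) :
    weightInput (fun R => (a R : ℚ)) (fun R => (b R : ℚ)) =
      (List.ofFn fun R => [a R, 1, b R, 1]).flatten := by
  simp [weightInput]

theorem comp_wfomc (Ψ : Fin m → Fin S.numPred) {Γ : S.lang.Sentence} (hΓ : WfomcPolyTime Γ) :
    Comp fun i : Instance S m => wfomc i.Δ i.names Γ (callWeight Ψ i) i.β := by
  obtain ⟨P, p, hP⟩ := hΓ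
  have hP' := fun i : Instance S m =>
    hP i.Δ i.names (fun R => (callWeight Ψ i R : ℚ)) (fun R => (i.β R : ℚ))
  choose t out hrun ht hout hval using hP'
  have hT : PolyBdd size fun i : Instance S m => p.eval (i.card +
      weightBits (fun R => (callWeight Ψ i R : ℚ)) (fun R => (i.β R : ℚ))) := by
    refine (polyBdd_card.add (.sum Finset.univ fun R _ => ?_)).eval p
    simp only [Rat.num_intCast, Rat.den_intCast]
    exact (((comp_callWeight Ψ R).bitLen.add (.const _)).add (comp_β R).bitLen).add (.const _)
  have hcall := PolyComp.call (sz := size) (inp := fun i : Instance S m => load i.input)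
    (L := inputLength S m) P
    ((fun i => (i.card : ℤ)) :: (List.ofFn fun R =>
      [fun i => callWeight Ψ i R, fun _ => 1, fun i => i.β R, fun _ => 1]).flatten)
    (fun f hf => by
      simp only [List.mem_cons, List.mem_flatten, List.mem_ofFn] at hf
      rcases hf with rfl | ⟨_, ⟨R, rfl⟩, hf⟩
      · exact comp_card
      · simp only [List.mem_cons, List.not_mem_nil, or_false] at hf
        rcases hf with rfl | rfl | rfl | rfl
        exacts [comp_callWeight Ψ R, .const 1, comp_β R, .const 1])
    hT (out := out) fun i => ⟨t i, ht i, by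
      have := hrun i
      rw [weightInput_intCast] at this
      simpa [List.map_flatten, List.map_ofFn, Function.comp_def] using this⟩
  -- The weights of the call are integers, so the model count is one too, and exact division of the
  -- returned fraction yields it.
  refine ((hcall 0).div (hcall 1)).congr fun i => ?_
  have h1 : (out i 1 : ℚ) ≠ 0 := by exact_mod_cast hout i
  have := hval i
  rw [wfomc_intCast, div_eq_iff h1] at this
  have h0 : out i 0 = wfomc i.Δ i.names Γ (callWeight Ψ i) i.β * out i 1 := by exact_mod_cast this
  rw [h0, Int.mul_ediv_cancel _ (hout i)]

end Instance

end WMCFun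

open WMCFun in
theorem mainTheorem6 (S : WMCFun.Signature) (Γ : S.lang.Sentence) (m : ℕ)
    (Ψ : Fin m → Fin S.numPred) (hΓ : WMCFun.WfomcPolyTime Γ) :
    WMCFun.WmcPolyTime Γ Ψ := by
  -- `inputLength` exceeds the true length of the input by one, which guarantees `2 ≤ L` even
  -- without predicates.
  obtain ⟨P, T, ⟨q, hq⟩, hP⟩ := exists_computesWithin (by unfold Instance.inputLength; omega)
    (Instance.comp_inRange.mul (Instance.comp_coeffAt (Instance.comp_wfomc Ψ hΓ)))
    Instance.comp_denom Instance.denom_ne_zero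
  simp only [Instance.inRange_mul_coeffAt] at hP
  have hrun : ∀ (i : Instance S m) (B : ℕ), q.eval i.size ≤ B → ComputesWithin P i.input B
      (wmc i.Δ i.names Ψ Γ i.n i.w i.wbar) := fun i B hB => by
    obtain ⟨t, s, hr, ht, h⟩ := hP i
    exact ⟨t, s, hr, (ht.trans (hq i)).trans hB, h⟩
  -- For `n` in range, `bitLen (n k) ≤ |Δ| ^ arity + 1`, so substituting this bound into `q` removes
  -- the dependence on the bits of `n`.
  refine ⟨P, q.comp (Polynomial.X + ∑ k, (Polynomial.X ^ S.arity (Ψ k) + 1)), q,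
    fun Δ _ names w wbar n => ⟨fun hn => ?_, ?_⟩⟩
  · refine hrun ⟨Δ, names, w, wbar, n⟩ _ ?_
    rw [Polynomial.eval_comp]
    refine eval_nat_mono q ?_
    simp only [Instance.size, Polynomial.eval_add, Polynomial.eval_X, Polynomial.eval_finsetSum,
      Polynomial.eval_pow, Polynomial.eval_one]
    refine Nat.add_le_add_left (Finset.sum_le_sum fun k _ => (bitLen_le_natAbs _).trans ?_) _
    have h1 : (n k).natAbs ≤ Fintype.card Δ ^ S.arity (Ψ k) := by
      have h2 := hn k
      zify
      rw [abs_of_nonneg h2.1]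
      exact h2.2
    have h3 := Nat.pow_le_pow_left (Nat.le_add_right (Fintype.card Δ) (weightBits w wbar))
      (S.arity (Ψ k))
    exact Nat.succ_le_succ (h1.trans h3)
  · exact hrun ⟨Δ, names, w, wbar, n⟩ _ le_rfl
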